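/- Let $N\ge 0$, let $\theta$ be a fixed parameter, $f(\cdot,\cdot,\theta):\mathbb R^N\times\mathbb R\to\mathbb R^N$, $\sigma:\mathbb R\to\mathbb R$ (applied to vectors componentwise, with $\sigma'(m)=\operatorname{diag}(\sigma'(m_1),\dots,\sigma'(m_N))$), and let $\gamma,\xi\in\mathbb R$ (in applications $\gamma,\xi>0$) and $t_0<T$. Let $(h(t),m(t))$, $t\in[t_0,T]$, be a solution of the generalized heavy ball neural ODE $$h'(t)=\sigma(m(t)),\qquad m'(t)=-\gamma m(t)+f(h(t),t,\theta)-\xi h(t),$$ and let $\mathcal L:\mathbb R^N\times\mathbb R^N\to\mathbb R$ be a loss function of the final state that is differentiable at $(h(T),m(T))$. For $t\in[t_0,T]$ regard $\mathcal L$ of the final state at time $T$ as a function of the state at time $t$, through the solution of the system on $[t,T]$, and let the row vectors $a_h(t):=\partial\mathcal L/\partial h(t)$ and $a_m(t):=\partial\mathcal L/\partial m(t)$ (the adjoint states) be its partial derivatives at $(h(t),m(t))$. Consider the adjoint equations $$a_h'(t)=-a_m(t)\Big(\frac{\partial f}{\partial h}(h(t),t,\theta)-\xi I\Big),\qquad a_m'(t)=-a_h(t)\,\sigma'(m(t))+\gamma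 a_m(t).$$ (i) Suppose that $f(\cdot,\cdot,\theta)$ is continuous and has a continuous Jacobian $\partial f/\partial h$ on $\mathbb R^N\times[t_0,T]$, and that $\sigma$ is $C^1$. Then for every $t\in[t_0,T]$ all states near $(h(t),m(t))$ at time $t$ lead to exactly one final state at time $T$, the loss is differentiable in the state at time $t$ at $(h(t),m(t))$, so that the adjoint states exist; $a_h(T)=\partial\mathcal L/\partial h_T$ and $a_m(T)=\partial\mathcal L/\partial m_T$, where $h_T=h(T)$, $m_T=m(T)$; and the adjoint equations hold for every $t\in[t_0,T]$ (with one-sided derivatives at the end points). (ii) Suppose only that on $[t_0,T]$ the function $f(h,t,\theta)$ is continuous in $t$ and, on bounded sets, Lipschitz in $h$ uniformly in $t$, that $\sigma$ is locally Lipschitz, and that for almost every $t\in[t_0,T]$ the derivatives $\partial f/\partial h(h(t),t,\theta)$ and $\sigma'(m_i(t))$, $1\le i\le N$, exist. Then the adjoint states exist at every $t\in[t_0,T]$ in the same sense and have the same values at $T$, they are Lipschitz functions of $t$ on $[t_0,T]$, and they satisfy the adjoint equations for almost every $t\in[t_0,T]$. -/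

import Mathlib

open Set Filter Topology MeasureTheory
open scoped NNReal

/-- The space of hidden features `ℝᴺ` with its Euclidean structure. -/
abbrev Feat (N : ℕ) : Type := EuclideanSpace ℝ (Fin N)

namespace GHBNODE

variable {N : ℕ} {Θ : Type*}

/-- The activation `σ` applied to every component of a vector. -/
noncomputable def act (σ : ℝ → ℝ) (m : Feat N) : Feat N :=
  WithLp.toLp 2 (fun i => σ (m i))

/-- The matrix `σ'(m)`, that is `diag (σ'(m₁), …, σ'(m_N))`, as a linear map. -/
noncomputable def actDeriv (σ : ℝ → ℝ) (m : Feat N) : Feat N →L[ℝ] Feat N :=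
  Matrix.toEuclideanCLM (𝕜 := ℝ) (Matrix.diagonal (fun i => deriv σ (m i)))

/-- `∂f/∂h (x, t, θ)`, the Jacobian of `f` in its first argument. -/
noncomputable def jac (f : Feat N → ℝ → Θ → Feat N) (θ : Θ) (x : Feat N) (t : ℝ) :
    Feat N →L[ℝ] Feat N :=
  fderiv ℝ (fun y => f y t θ) x

/-- `(h, m)` solves `h' = σ(m)`, `m' = -γ m + f(h, t, θ) - ξ h` on `[a, b]`
(one-sided derivatives at the end points). -/
def IsSolution (f : Feat N → ℝ → Θ → Feat N) (θ : Θ) (σ : ℝ → ℝ) (γ ξ a b : ℝ)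
    (h m : ℝ → Feat N) : Prop :=
  ∀ t ∈ Icc a b,
    HasDerivWithinAt h (act σ (m t)) (Icc a b) t ∧
    HasDerivWithinAt m (-(γ • m t) + f (h t) t θ - ξ • h t) (Icc a b) t

/-- Some solution on `[t, T]` goes from the state `p` at time `t` to the state `q` at time `T`. -/
def Reaches (f : Feat N → ℝ → Θ → Feat N) (θ : Θ) (σ : ℝ → ℝ) (γ ξ t T : ℝ)
    (p q : Feat N × Feat N) : Prop :=
  ∃ h m : ℝ → Feat N, IsSolution f θ σ γ ξ t T h m ∧ (h t, m t) = p ∧ (h T, m T) = q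

/-- The final state at time `T` of the solution that is in the state `p` at time `t`
(meaningful when exactly one final state is reached from `p`). -/
noncomputable def finalState (f : Feat N → ℝ → Θ → Feat N) (θ : Θ) (σ : ℝ → ℝ) (γ ξ T t : ℝ)
    (p : Feat N × Feat N) : Feat N × Feat N :=
  Classical.epsilon (fun q => Reaches f θ σ γ ξ t T p q)

/-- The loss of the final state, as a function of the state `p` at time `t`. -/
noncomputable def lossFrom (f : Feat N → ℝ → Θ → Feat N) (θ : Θ) (σ : ℝ → ℝ) (γ ξ T : ℝ)
    (L : Feat N × Feat N → ℝ) (t : ℝ) (p : Feat N × Feat N) : ℝ :=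
  L (finalState f θ σ γ ξ T t p)

/-- The adjoint state `a_h(t) = ∂L/∂h(t)` along the trajectory `(h, m)`, a row vector. -/
noncomputable def adjointH (f : Feat N → ℝ → Θ → Feat N) (θ : Θ) (σ : ℝ → ℝ) (γ ξ T : ℝ)
    (L : Feat N × Feat N → ℝ) (h m : ℝ → Feat N) (t : ℝ) : Feat N →L[ℝ] ℝ :=
  fderiv ℝ (fun x => lossFrom f θ σ γ ξ T L t (x, m t)) (h t)

/-- The adjoint state `a_m(t) = ∂L/∂m(t)` along the trajectory `(h, m)`, a row vector. -/
noncomputable def adjointM (f : Feat N → ℝ → Θ → Feat N) (θ : Θ) (σ : ℝ → ℝ) (γ ξ T : ℝ)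
    (L : Feat N × Feat N → ℝ) (h m : ℝ → Feat N) (t : ℝ) : Feat N →L[ℝ] ℝ :=
  fderiv ℝ (fun y => lossFrom f θ σ γ ξ T L t (h t, y)) (m t)

/-- The adjoint states along `(h, m)` exist at time `t`: every state near `(h t, m t)` leads to
exactly one final state, and the loss is differentiable in the state at time `t`. -/
def AdjointExistsAt (f : Feat N → ℝ → Θ → Feat N) (θ : Θ) (σ : ℝ → ℝ) (γ ξ T : ℝ)
    (L : Feat N × Feat N → ℝ) (h m : ℝ → Feat N) (t : ℝ) : Prop :=
  (∀ᶠ p in 𝓝 (h t, m t), ∃! q, Reaches f θ σ γ ξ t T p q) ∧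
    DifferentiableAt ℝ (lossFrom f θ σ γ ξ T L t) (h t, m t)

/-- The adjoint equations at time `t`, for the derivative within `[t₀, T]`:
`a_h' = -a_m (∂f/∂h - ξ I)` and `a_m' = -a_h σ'(m) + γ a_m`. -/
def AdjointEquationsAt (f : Feat N → ℝ → Θ → Feat N) (θ : Θ) (σ : ℝ → ℝ) (γ ξ t₀ T : ℝ)
    (L : Feat N × Feat N → ℝ) (h m : ℝ → Feat N) (t : ℝ) : Prop :=
  HasDerivWithinAt (adjointH f θ σ γ ξ T L h m)
      (-(adjointM f θ σ γ ξ T L h m t ∘L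
        (jac f θ (h t) t - ξ • ContinuousLinearMap.id ℝ (Feat N))))
      (Icc t₀ T) t ∧
    HasDerivWithinAt (adjointM f θ σ γ ξ T L h m)
      (-(adjointH f θ σ γ ξ T L h m t ∘L actDeriv σ (m t))
        + γ • adjointM f θ σ γ ξ T L h m t)
      (Icc t₀ T) t

/-- The values of the adjoint states at the final time:
`a_h(T) = ∂L/∂h_T` and `a_m(T) = ∂L/∂m_T`. -/
def AdjointFinalValues (f : Feat N → ℝ → Θ → Feat N) (θ : Θ) (σ : ℝ → ℝ) (γ ξ T : ℝ)
    (L : Feat N × Feat N → ℝ) (h m : ℝ → Feat N) : Prop :=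
  adjointH f θ σ γ ξ T L h m T = fderiv ℝ (fun x => L (x, m T)) (h T) ∧
    adjointM f θ σ γ ξ T L h m T = fderiv ℝ (fun y => L (h T, y)) (m T)

/-- `f` and `σ` are continuously differentiable: on `ℝᴺ × [t₀, T]`, `f` is continuous and has a
continuous Jacobian `∂f/∂h`, and `σ` is `C¹`. -/
def SmoothData (f : Feat N → ℝ → Θ → Feat N) (θ : Θ) (σ : ℝ → ℝ) (t₀ T : ℝ) : Prop :=
  ContinuousOn (fun q : Feat N × ℝ => f q.1 q.2 θ) (univ ×ˢ Icc t₀ T) ∧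
    (∀ t ∈ Icc t₀ T, Differentiable ℝ (fun x => f x t θ)) ∧
    ContinuousOn (fun q : Feat N × ℝ => jac f θ q.1 q.2) (univ ×ˢ Icc t₀ T) ∧
    ContDiff ℝ 1 σ

/-- On `[t₀, T]`, `f` is continuous in `t` and Lipschitz in `h` on bounded sets uniformly in `t`,
and `σ` is locally Lipschitz. -/
def LipschitzData (f : Feat N → ℝ → Θ → Feat N) (θ : Θ) (σ : ℝ → ℝ) (t₀ T : ℝ) : Prop :=
  (∀ x, ContinuousOn (fun t => f x t θ) (Icc t₀ T)) ∧
    (∀ R : ℝ, ∃ K : ℝ≥0, ∀ t ∈ Icc t₀ T,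
      LipschitzOnWith K (fun x => f x t θ) (Metric.closedBall 0 R)) ∧
    LocallyLipschitz σ

end GHBNODE

/-! ### Integral equations on a whole interval. -/

namespace GHBNODE

/-! Write the system as `x' = V(s, x)` on the product space, put `A(s) = DV_s(x(s))` and let `ℓ` be
the derivative of the loss at the final state. The flow is never differentiated. Instead, the
candidate adjoint is constructed as the solution of the linear equation `α(t) = ℓ + ∫ s in t..T,
α(s) A(s)`, and is then shown to be the derivative of the loss in the state at time `t`.

For a solution `y` starting at `p` near `x(t)`, put `w = y - x`. Almost everywhere `(α w)' = α (w' -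
A w)`, so integration gives `ℓ (w(T)) - α(t) (p - x(t))` as the integral of `α` applied to the
linearization error `V(y) - V(x) - A w` (`adjoint_pairing`). Gronwall bounds `w` by a multiple of `p
- x(t)` (`IsIntegralCurve.exists_near`). Hence the error, divided by `‖p - x(t)‖`, is bounded by the
Lipschitz property and tends to zero at almost every time by differentiability; by dominated
convergence its integral is `o(p - x(t))` (`hasFDerivAt_of_adjoint`). Differentiability along the
trajectory at almost every time is all that this needs, so one argument serves both kinds of data.

The adjoint equations are the two blocks of `α' = -α A`. This holds at every time when `A` is
continuous, and at almost every time by Lebesgue differentiation when `A` is only bounded and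
measurable. -/

theorem exists_integral_equation_solution {X : Type*} [NormedAddCommGroup X] [NormedSpace ℝ X]
    [CompleteSpace X] {G : ℝ → X → X} {K : ℝ≥0} (hG : ∀ s, LipschitzWith K (G s))
    (hint : ∀ x : ℝ → X, Continuous x → ∀ a b, IntervalIntegrable (fun s => G s (x s)) volume a b)
    {a b : ℝ} (hab : a ≤ b) (p : X) :
    ∃ x : ℝ → X, Continuous x ∧ ∀ t ∈ Icc a b, x t = p + ∫ s in a..t, G s (x s) := by
  -- Picard iteration in an exponentially weighted norm contracts on the whole interval at once. The
  -- rate makes `K / lam ≤ 1 / 2`, and the summand `1` keeps it positive when `K = 0`.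
  set lam : ℝ := 2 * K + 1 with hlam
  have hK0 : (0 : ℝ) ≤ K := K.2
  have hlam0 : 0 < lam := by positivity
  let E : ℝ → ℝ := fun t => Real.exp (lam * (t - a))
  have hE : Continuous E := by fun_prop
  have hEpos : ∀ t, 0 < E t := fun t => Real.exp_pos _
  -- The fixed point is sought for the solution divided by the weight, so that the usual sup metric
  -- plays the role of the weighted one.
  let ext : C(Icc a b, X) → ℝ → X := fun u t => E t • IccExtend hab u t
  have hext : ∀ u, Continuous (ext u) := fun u => hE.smul (u.continuous.Icc_extend')
  have hprim : ∀ u, Continuous fun t => ∫ s in a..t, G s (ext u s) := fun u =>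
    intervalIntegral.continuous_primitive (fun c d => hint _ (hext u) c d) a
  let F : C(Icc a b, X) → C(Icc a b, X) := fun u =>
    ⟨fun t => (E t)⁻¹ • (p + ∫ s in a..(t : ℝ), G s (ext u s)), by
      have := hprim u
      have h2 : Continuous fun t : ℝ => (E t)⁻¹ := hE.inv₀ fun t => (hEpos t).ne'
      exact ((h2.smul (continuous_const.add this)).comp continuous_subtype_val)⟩
  have hF : ContractingWith (1 / 2) F := by
    refine ⟨by rw [← NNReal.coe_lt_coe]; norm_num, LipschitzWith.of_dist_le_mul fun u v => ?_⟩
    rw [ContinuousMap.dist_le (by positivity)]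
    rintro ⟨t, ht⟩
    change dist ((E t)⁻¹ • (p + ∫ s in a..t, G s (ext u s)))
      ((E t)⁻¹ • (p + ∫ s in a..t, G s (ext v s))) ≤ _
    rw [dist_eq_norm, ← smul_sub, add_sub_add_left_eq_sub,
      ← intervalIntegral.integral_sub (hint _ (hext u) _ _) (hint _ (hext v) _ _), norm_smul,
      Real.norm_of_nonneg (inv_nonneg.2 (hEpos t).le)]
    have hderiv : ∀ s, HasDerivAt (fun s => K * dist u v / lam * E s) (K * dist u v * E s) s := by
      intro s
      have h1 : HasDerivAt (fun s => lam * (s - a)) lam s := by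
        simpa using ((hasDerivAt_id s).sub_const a).const_mul lam
      have := h1.exp.const_mul (K * dist u v / lam)
      refine this.congr_deriv ?_
      simp only [E]; field_simp
    have hbd : ‖∫ s in a..t, (G s (ext u s) - G s (ext v s))‖
        ≤ ∫ s in a..t, K * dist u v * E s := by
      refine intervalIntegral.norm_integral_le_of_norm_le ht.1 (Eventually.of_forall fun s _ => ?_)
        ((by fun_prop : Continuous fun s => K * dist u v * E s).intervalIntegrable _ _)
      rw [← dist_eq_norm]
      refine ((hG s).dist_le_mul _ _).trans ?_
      rw [mul_assoc]
      gcongr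
      simp only [ext]
      rw [dist_eq_norm, ← smul_sub, norm_smul, Real.norm_of_nonneg (hEpos s).le, mul_comm,
        ← dist_eq_norm]
      gcongr
      · exact ContinuousMap.dist_apply_le_dist _
    rw [intervalIntegral.integral_eq_sub_of_hasDerivAt (fun s _ => hderiv s)
      ((by fun_prop : Continuous fun s => K * dist u v * E s).intervalIntegrable _ _)] at hbd
    have hd : 0 ≤ dist u v := dist_nonneg
    have hEa : 0 < E a := hEpos a
    have : K * dist u v / lam * E t - K * dist u v / lam * E a ≤ 1 / 2 * dist u v * E t := by
      have h1 : K * dist u v / lam ≤ 1 / 2 * dist u v := by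
        rw [div_le_iff₀ hlam0]; nlinarith
      have h2 : 0 ≤ K * dist u v / lam * E a := by positivity
      nlinarith [hEpos t]
    rw [inv_mul_le_iff₀ (hEpos t)]
    calc _ ≤ _ := hbd
      _ ≤ _ := this
      _ = _ := by push_cast; ring
  have : Nonempty C(Icc a b, X) := ⟨0⟩
  set u := ContractingWith.fixedPoint F hF
  have hu : F u = u := hF.fixedPoint_isFixedPt
  refine ⟨ext u, hext u, fun t ht => ?_⟩
  have : u ⟨t, ht⟩ = (E t)⁻¹ • (p + ∫ s in a..t, G s (ext u s)) := by
    conv_lhs => rw [← hu]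
    rfl
  simp only [ext, IccExtend_of_mem hab u ht]
  rw [this, smul_inv_smul₀ (hEpos t).ne']

/-! ### Radial retraction. -/

/-- The radial retraction onto the closed unit ball. -/
noncomputable def radialRetraction {X : Type*} [NormedAddCommGroup X] [NormedSpace ℝ X] (x : X) :
    X :=
  (max 1 ‖x‖)⁻¹ • x

section Retraction
variable {X : Type*} [NormedAddCommGroup X] [NormedSpace ℝ X]

theorem radialRetraction_of_norm_le_one {x : X} (hx : ‖x‖ ≤ 1) : radialRetraction x = x := by
  simp [radialRetraction, max_eq_left hx]

theorem norm_radialRetraction_le (x : X) : ‖radialRetraction x‖ ≤ 1 := by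
  have : 0 < max 1 ‖x‖ := by positivity
  rw [radialRetraction, norm_smul, Real.norm_of_nonneg (by positivity), inv_mul_le_iff₀ this]
  simp

/-- The difference splits into a rescaled `x - y` and a change of scaling factor on `y`, each of
norm at most `‖x - y‖`. This works in every normed space, as is needed for the product state space
with its sup norm. -/
theorem lipschitzWith_radialRetraction : LipschitzWith 2 (radialRetraction (X := X)) := by
  refine LipschitzWith.of_dist_le_mul fun x y => ?_
  rw [dist_eq_norm, dist_eq_norm]
  set A := max 1 ‖x‖
  set B := max 1 ‖y‖
  have hA : 1 ≤ A := le_max_left _ _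
  have hB : 1 ≤ B := le_max_left _ _
  have hyB : ‖y‖ ≤ B := le_max_right _ _
  have hAB : |B - A| ≤ ‖x - y‖ := by
    have h1 := abs_max_sub_max_le_abs ‖y‖ ‖x‖ 1
    rw [max_comm, max_comm ‖x‖] at h1
    rw [norm_sub_rev]
    exact h1.trans (abs_norm_sub_norm_le _ _)
  have hdec : radialRetraction x - radialRetraction y
      = A⁻¹ • (x - y) + (A⁻¹ * ((B - A) * B⁻¹)) • y := by
    have : A⁻¹ * ((B - A) * B⁻¹) = A⁻¹ - B⁻¹ := by
      field_simp
    rw [this, smul_sub, sub_smul]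
    simp only [radialRetraction]
    abel
  rw [hdec]
  refine (norm_add_le _ _).trans ?_
  rw [norm_smul, norm_smul, norm_mul, norm_mul, Real.norm_of_nonneg (by positivity : 0 ≤ A⁻¹),
    Real.norm_of_nonneg (by positivity : 0 ≤ B⁻¹), Real.norm_eq_abs]
  have hA1 : A⁻¹ ≤ 1 := inv_le_one_of_one_le₀ hA
  have hA0 : 0 ≤ A⁻¹ := by positivity
  have h1 : A⁻¹ * ‖x - y‖ ≤ ‖x - y‖ := mul_le_of_le_one_left (norm_nonneg _) hA1
  have h2 : B⁻¹ * ‖y‖ ≤ 1 := by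
    rw [inv_mul_le_iff₀ (by positivity)]; simpa using hyB
  have h3 : A⁻¹ * (|B - A| * B⁻¹) * ‖y‖ ≤ ‖x - y‖ := by
    calc A⁻¹ * (|B - A| * B⁻¹) * ‖y‖ = A⁻¹ * |B - A| * (B⁻¹ * ‖y‖) := by ring
      _ ≤ 1 * ‖x - y‖ * 1 := by gcongr
      _ = _ := by ring
  push_cast
  linarith

end Retraction

/-! ### Uniqueness and stability of solutions. -/

/-- `y` solves `y' = V(t, y)` on `[a, b]` (one-sided derivatives at the end points). -/
def IsIntegralCurve {X : Type*} [NormedAddCommGroup X] [NormedSpace ℝ X] (V : ℝ → X → X)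
    (a b : ℝ) (y : ℝ → X) : Prop :=
  ∀ t ∈ Icc a b, HasDerivWithinAt y (V t (y t)) (Icc a b) t

section Flow
variable {X : Type*} [NormedAddCommGroup X] [NormedSpace ℝ X] {V : ℝ → X → X} {a b : ℝ}

theorem IsIntegralCurve.continuousOn {y : ℝ → X} (hy : IsIntegralCurve V a b y) :
    ContinuousOn y (Icc a b) := fun t ht => (hy t ht).continuousWithinAt

theorem IsIntegralCurve.hasDerivWithinAt_Ici {y : ℝ → X} (hy : IsIntegralCurve V a b y) {t : ℝ}
    (ht : t ∈ Ico a b) : HasDerivWithinAt y (V t (y t)) (Ici t) t :=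
  (hy t (Ico_subset_Icc_self ht)).mono_of_mem_nhdsWithin
    (mem_of_superset (Icc_mem_nhdsGE ht.2) (Icc_subset_Icc_left ht.1))

theorem IsIntegralCurve.mono {y : ℝ → X} (hy : IsIntegralCurve V a b y) {c : ℝ} (hc : a ≤ c) :
    IsIntegralCurve V c b y := fun t ht =>
  (hy t ⟨hc.trans ht.1, ht.2⟩).mono (Icc_subset_Icc_left hc)

theorem IsIntegralCurve.eqOn (hlip : ∀ R : ℝ, ∃ K : ℝ≥0, ∀ t,
      LipschitzOnWith K (V t) (Metric.closedBall 0 R))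
    {y z : ℝ → X} (hy : IsIntegralCurve V a b y) (hz : IsIntegralCurve V a b z)
    (h : y a = z a) : EqOn y z (Icc a b) := by
  obtain ⟨R₁, hR₁⟩ := isCompact_Icc.exists_bound_of_continuousOn hy.continuousOn
  obtain ⟨R₂, hR₂⟩ := isCompact_Icc.exists_bound_of_continuousOn hz.continuousOn
  obtain ⟨K, hK⟩ := hlip (max R₁ R₂)
  refine ODE_solution_unique_of_mem_Icc_right (v := V)
    (s := fun _ => Metric.closedBall 0 (max R₁ R₂)) (K := K) (fun t _ => hK t) hy.continuousOn
    (fun t ht => hy.hasDerivWithinAt_Ici ht) (fun t ht => ?_) hz.continuousOn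
    (fun t ht => hz.hasDerivWithinAt_Ici ht) (fun t ht => ?_) h
  · simpa using Or.inl (hR₁ t (Ico_subset_Icc_self ht))
  · simpa using Or.inr (hR₂ t (Ico_subset_Icc_self ht))

/-- Solutions that start near a given solution exist as long as it does, and depend on the
initial state in a Lipschitz way. -/
theorem IsIntegralCurve.exists_near [CompleteSpace X] (hV : Continuous fun q : ℝ × X => V q.1 q.2)
    (hlip : ∀ R : ℝ, ∃ K : ℝ≥0, ∀ t, LipschitzOnWith K (V t) (Metric.closedBall 0 R))
    {x : ℝ → X} (hxc : Continuous x) {M : ℝ} (hM : ∀ t, ‖x t‖ ≤ M)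
    (hx : IsIntegralCurve V a b x) :
    ∃ C > 0, ∀ t ∈ Icc a b, ∀ p, ‖p - x t‖ ≤ C⁻¹ →
      ∃ y, Continuous y ∧ IsIntegralCurve V t b y ∧ y t = p ∧
        ∀ s ∈ Icc t b, ‖y s - x s‖ ≤ C * ‖p - x t‖ := by
  obtain ⟨K, hK⟩ := hlip (M + 1)
  -- The field is modified outside the tube of radius one around `x`. It becomes globally Lipschitz,
  -- hence has solutions up to time `b`, and `x` still solves the modified equation.
  let W : ℝ → X → X := fun s z => V s (x s + radialRetraction (z - x s))
  have hW : ∀ s, LipschitzWith (K * 2) (W s) := by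
    intro s
    have hin : ∀ z, x s + radialRetraction (z - x s) ∈ Metric.closedBall (0 : X) (M + 1) := by
      intro z
      rw [mem_closedBall_zero_iff]
      exact (norm_add_le _ _).trans (add_le_add (hM s) (norm_radialRetraction_le _))
    refine LipschitzWith.of_dist_le_mul fun z w => ?_
    refine ((hK s).dist_le_mul _ (hin z) _ (hin w)).trans ?_
    rw [dist_add_left]
    have := lipschitzWith_radialRetraction.dist_le_mul (z - x s) (w - x s)
    rw [dist_sub_right] at this
    push_cast at this ⊢
    rw [mul_assoc]
    gcongr
  have hWc : ∀ z : ℝ → X, Continuous z → Continuous fun s => W s (z s) := by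
    intro z hz
    exact hV.comp (continuous_id.prodMk (hxc.add
      (lipschitzWith_radialRetraction.continuous.comp (hz.sub hxc))))
  -- This is the Gronwall factor over the full interval, hence uniform in `t`. Starting within its
  -- inverse keeps the solution in the tube, where `W` equals `V`.
  refine ⟨Real.exp ((K * 2 : ℝ≥0) * (b - a)), Real.exp_pos _, fun t ht p hp => ?_⟩
  obtain ⟨y, hyc, hy⟩ := exists_integral_equation_solution hW
    (fun z hz _ _ => (hWc z hz).intervalIntegrable _ _) ht.2 p
  have hyt : y t = p := by simpa using hy t ⟨le_rfl, ht.2⟩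
  have hyW : IsIntegralCurve W t b y := by
    intro s hs
    have h1 : HasDerivAt (fun s => p + ∫ r in t..s, W r (y r)) (W s (y s)) s :=
      (intervalIntegral.integral_hasDerivAt_right ((hWc y hyc).intervalIntegrable _ _)
        ((hWc y hyc).stronglyMeasurableAtFilter _ _) (hWc y hyc).continuousAt).const_add p
    exact h1.hasDerivWithinAt.congr (fun r hr => hy r hr) (hy s hs)
  have hxW : IsIntegralCurve W t b x := by
    intro s hs
    have := hx.mono ht.1 s hs
    simpa [W, radialRetraction_of_norm_le_one] using this
  have hbd : ∀ s ∈ Icc t b, ‖y s - x s‖ ≤ Real.exp ((K * 2 : ℝ≥0) * (b - a)) * ‖p - x t‖ := by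
    intro s hs
    have := dist_le_of_trajectories_ODE hW hyW.continuousOn
      (fun r hr => hyW.hasDerivWithinAt_Ici hr) hxW.continuousOn
      (fun r hr => hxW.hasDerivWithinAt_Ici hr) (le_refl (dist (y t) (x t))) s hs
    rw [dist_eq_norm, dist_eq_norm, hyt] at this
    rw [mul_comm]
    refine this.trans ?_
    gcongr
    · exact hs.2
    · exact ht.1
  refine ⟨y, hyc, fun s hs => ?_, hyt, hbd⟩
  have h1 : ‖y s - x s‖ ≤ 1 := by
    refine (hbd s hs).trans ((mul_le_mul_of_nonneg_left hp (Real.exp_pos _).le).trans ?_)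
    rw [mul_inv_cancel₀ (Real.exp_pos _).ne']
  have := hyW s hs
  simpa [W, radialRetraction_of_norm_le_one h1] using this

end Flow
-- The integrated linear adjoint equation.
section Adjoint
variable {X : Type*} [NormedAddCommGroup X] [NormedSpace ℝ X] [FiniteDimensional ℝ X]
  {A : ℝ → X →L[ℝ] X} {K : ℝ≥0} {a b : ℝ}

theorem intervalIntegrable_comp (hA : StronglyMeasurable A) (hK : ∀ s, ‖A s‖ ≤ K)
    {α : ℝ → X →L[ℝ] ℝ} (hα : Continuous α) (c d : ℝ) :
    IntervalIntegrable (fun s => (α s).comp (A s)) volume c d := by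
  have h1 : IntervalIntegrable (fun s => ‖α s‖ * K) volume c d :=
    (hα.norm.mul continuous_const).intervalIntegrable _ _
  refine h1.mono_fun ?_ (Eventually.of_forall fun s => ?_)
  · have hc : Continuous fun q : (X →L[ℝ] ℝ) × (X →L[ℝ] X) => q.1.comp q.2 :=
      continuous_fst.clm_comp continuous_snd
    exact (hc.comp_stronglyMeasurable
      (hα.stronglyMeasurable.prodMk hA)).aestronglyMeasurable
  · change ‖(α s).comp (A s)‖ ≤ ‖‖α s‖ * (K : ℝ)‖
    rw [Real.norm_of_nonneg (by positivity)]
    exact (ContinuousLinearMap.opNorm_comp_le _ _).trans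
      (mul_le_mul_of_nonneg_left (hK s) (norm_nonneg _))

/-- Reversing time turns this terminal value problem into an initial value problem with a Lipschitz
right-hand side that is only measurable in time. -/
theorem exists_adjoint (hA : StronglyMeasurable A) (hK : ∀ s, ‖A s‖ ≤ K) (hab : a ≤ b)
    (ℓ : X →L[ℝ] ℝ) :
    ∃ α : ℝ → X →L[ℝ] ℝ, Continuous α ∧
      ∀ t ∈ Icc a b, α t = ℓ + ∫ s in t..b, (α s).comp (A s) := by
  have hA' : StronglyMeasurable fun s => A (-s) := hA.comp_measurable measurable_neg
  obtain ⟨β, hβc, hβ⟩ := exists_integral_equation_solution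
    (G := fun s (β : X →L[ℝ] ℝ) => β.comp (A (-s))) (K := K)
    (fun s => LipschitzWith.of_dist_le_mul fun u v => by
      rw [dist_eq_norm, dist_eq_norm, ← ContinuousLinearMap.sub_comp, mul_comm]
      exact (ContinuousLinearMap.opNorm_comp_le _ _).trans
        (mul_le_mul_of_nonneg_left (hK _) (norm_nonneg _)))
    (fun β hβ c d => intervalIntegrable_comp hA' (fun s => hK _) hβ c d) (neg_le_neg hab) ℓ
  refine ⟨fun s => β (-s), hβc.comp continuous_neg, fun t ht => ?_⟩
  change β (-t) = ℓ + ∫ s in t..b, (β (-s)).comp (A s)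
  rw [hβ (-t) ⟨neg_le_neg ht.2, neg_le_neg ht.1⟩,
    ← intervalIntegral.integral_comp_neg (fun s => (β s).comp (A (-s)))]
  simp only [neg_neg]

theorem lipschitzOnWith_of_integral_equation (hA : StronglyMeasurable A) (hK : ∀ s, ‖A s‖ ≤ K)
    {α : ℝ → X →L[ℝ] ℝ} (hα : Continuous α) {ℓ : X →L[ℝ] ℝ}
    (hℓ : ∀ t ∈ Icc a b, α t = ℓ + ∫ s in t..b, (α s).comp (A s)) :
    ∃ C : ℝ≥0, LipschitzOnWith C α (Icc a b) := by
  obtain ⟨R, hR⟩ := isCompact_Icc.exists_bound_of_continuousOn (hα.continuousOn (s := Icc a b))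
  refine ⟨R.toNNReal * K, LipschitzOnWith.of_dist_le_mul fun s hs t ht => ?_⟩
  have hi := fun c d => intervalIntegrable_comp hA hK hα c d
  rw [hℓ s hs, hℓ t ht, dist_add_left, dist_eq_norm,
    intervalIntegral.integral_interval_sub_interval_comm (hi _ _) (hi _ _) (hi _ _)]
  simp only [intervalIntegral.integral_same, sub_zero]
  rw [dist_comm, Real.dist_eq]
  refine intervalIntegral.norm_integral_le_of_norm_le_const fun r hr => ?_
  have hr' : r ∈ Icc a b :=
    uIcc_subset_Icc hs ht (uIoc_subset_uIcc hr)
  refine (ContinuousLinearMap.opNorm_comp_le _ _).trans ?_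
  push_cast
  gcongr
  · exact (hR r hr').trans (Real.le_coe_toNNReal R)
  · exact hK r

/-- The adjoint pairing of a solution with the difference of two curves. -/
theorem adjoint_pairing (hA : StronglyMeasurable A) (hK : ∀ s, ‖A s‖ ≤ K)
    {α : ℝ → X →L[ℝ] ℝ} (hα : Continuous α) {ℓ : X →L[ℝ] ℝ} (hab : a ≤ b)
    (hℓ : ∀ t ∈ Icc a b, α t = ℓ + ∫ s in t..b, (α s).comp (A s))
    {w w' : ℝ → X} (hw : ∀ s ∈ Icc a b, HasDerivWithinAt w (w' s) (Icc a b) s)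
    (hw' : ContinuousOn w' (Icc a b)) :
    α b (w b) - α a (w a) = ∫ s in a..b, α s (w' s - A s (w s)) := by
  have hwc : ContinuousOn w (Icc a b) := fun s hs => (hw s hs).continuousWithinAt
  obtain ⟨C, hC⟩ := lipschitzOnWith_of_integral_equation hA hK hα hℓ
  obtain ⟨R, hR⟩ := isCompact_Icc.exists_bound_of_continuousOn (hα.continuousOn (s := Icc a b))
  obtain ⟨S, hS⟩ := isCompact_Icc.exists_bound_of_continuousOn hwc
  obtain ⟨D, hD⟩ := isCompact_Icc.exists_bound_of_continuousOn hw'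
  have hwL : LipschitzOnWith D.toNNReal w (Icc a b) :=
    (convex_Icc a b).lipschitzOnWith_of_nnnorm_hasDerivWithin_le hw fun s hs => by
      rw [← NNReal.coe_le_coe, coe_nnnorm]
      exact (hD s hs).trans (Real.le_coe_toNNReal D)
  -- Since `A` is only measurable, `α` need not be differentiable everywhere. The pairing is still
  -- Lipschitz, hence absolutely continuous, and is the integral of its almost everywhere
  -- derivative.
  have hgL : LipschitzOnWith (R.toNNReal * D.toNNReal + C * S.toNNReal) (fun s => α s (w s))
      (uIcc a b) := by
    rw [uIcc_of_le hab]
    refine LipschitzOnWith.of_dist_le_mul fun s hs t ht => ?_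
    have hdec : α s (w s) - α t (w t) = α s (w s - w t) + (α s - α t : X →L[ℝ] ℝ) (w t) := by
      simp
    rw [dist_eq_norm, hdec]
    refine (norm_add_le _ _).trans ?_
    have h1 : ‖α s (w s - w t)‖ ≤ R.toNNReal * (D.toNNReal * dist s t) := by
      refine ((α s).le_opNorm _).trans ?_
      gcongr
      · exact (hR s hs).trans (Real.le_coe_toNNReal R)
      · rw [← dist_eq_norm]; exact hwL.dist_le_mul _ hs _ ht
    have h2 : ‖(α s - α t : X →L[ℝ] ℝ) (w t)‖ ≤ C * dist s t * S.toNNReal := by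
      refine ((α s - α t).le_opNorm _).trans ?_
      gcongr
      · rw [← dist_eq_norm]; exact hC.dist_le_mul _ hs _ ht
      · exact (hS t ht).trans (Real.le_coe_toNNReal S)
    refine (add_le_add h1 h2).trans (le_of_eq ?_)
    push_cast
    ring
  rw [← hgL.absolutelyContinuousOnInterval.integral_deriv_eq_sub]
  -- Discarding the right end point makes `Icc a b` a neighbourhood of the remaining times, so
  -- one-sided derivatives become two-sided.
  have h₁ : ∀ᵐ x : ℝ, x ≠ b := by simp [ae_iff, measure_singleton]
  refine intervalIntegral.integral_congr_ae ?_
  filter_upwards [(intervalIntegrable_comp hA hK hα a b).ae_hasDerivAt_integral, h₁] with s hs hsb hsm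
  rw [uIoc_of_le hab] at hsm
  have hs0 : s ∈ Icc a b := Ioc_subset_Icc_self hsm
  have hnhds : Icc a b ∈ 𝓝 s := Icc_mem_nhds hsm.1 (lt_of_le_of_ne hsm.2 hsb)
  have hd1 : HasDerivAt α (-((α s).comp (A s))) s := by
    have := (hs (by rwa [uIcc_of_le hab]) b right_mem_uIcc).const_sub ℓ
    refine this.congr_of_eventuallyEq ?_
    filter_upwards [hnhds] with r hr
    rw [hℓ r hr, intervalIntegral.integral_symm, sub_eq_add_neg]
  have hd2 := hd1.clm_apply ((hw s hs0).hasDerivAt hnhds)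
  rw [hd2.deriv]
  simp [map_sub]
  ring

end Adjoint

/-! ### Differentiability of the loss in the initial state. -/

section Main
variable {X : Type*} [NormedAddCommGroup X] [NormedSpace ℝ X] [FiniteDimensional ℝ X]
  {V : ℝ → X → X} {a b : ℝ}

/-- The first-order error of the loss is the error of `L` at the final state plus the integral of
`α` against the linearization error of the field. Both are `o(p - x t)`. -/
theorem hasFDerivAt_of_adjoint [MeasurableSpace X] [BorelSpace X]
    (hV : Continuous fun q : ℝ × X => V q.1 q.2)
    (hlip : ∀ R : ℝ, ∃ K : ℝ≥0, ∀ t, LipschitzOnWith K (V t) (Metric.closedBall 0 R))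
    {x : ℝ → X} (hxc : Continuous x) {M : ℝ} (hM : ∀ t, ‖x t‖ ≤ M)
    (hx : IsIntegralCurve V a b x) (hdiff : ∀ᵐ s, s ∈ Icc a b → DifferentiableAt ℝ (V s) (x s))
    (hA : StronglyMeasurable fun s => fderiv ℝ (V s) (x s))
    {α : ℝ → X →L[ℝ] ℝ} (hα : Continuous α)
    {L : X → ℝ} {ℓ : X →L[ℝ] ℝ} (hL : HasFDerivAt L ℓ (x b))
    (hℓ : ∀ t ∈ Icc a b, α t = ℓ + ∫ s in t..b, (α s).comp (fderiv ℝ (V s) (x s)))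
    {t : ℝ} (ht : t ∈ Icc a b) {Φ : X → X}
    (hΦ : ∀ᶠ p in 𝓝 (x t), ∃ y, IsIntegralCurve V t b y ∧ y t = p ∧ y b = Φ p) :
    HasFDerivAt (fun p => L (Φ p)) (α t) (x t) := by
  -- The ball of radius `M + 1` contains the unit tube around the trajectory. Its Lipschitz constant
  -- also bounds `fderiv` at exceptional times, where the default value is zero.
  obtain ⟨K, hK⟩ := hlip (M + 1)
  have hball : ∀ s, Metric.closedBall (0 : X) (M + 1) ∈ 𝓝 (x s) := fun s =>
    Metric.closedBall_mem_nhds_of_mem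
      (by rw [mem_ball_zero_iff]; exact (hM s).trans_lt (lt_add_one M))
  have hAK : ∀ s, ‖fderiv ℝ (V s) (x s)‖ ≤ K := fun s =>
    norm_fderiv_le_of_lipschitzOn ℝ (hball s) (hK s)
  obtain ⟨C, hC0, hC⟩ := hx.exists_near hV hlip hxc hM
  have hsmall : ∀ᶠ p in 𝓝 (x t), ‖p - x t‖ ≤ C⁻¹ := by
    filter_upwards [Metric.closedBall_mem_nhds (x t) (inv_pos.2 hC0)] with p hp
    rwa [← dist_eq_norm]
  have hgood : ∀ᶠ p in 𝓝 (x t), ∃ y, Continuous y ∧ IsIntegralCurve V t b y ∧ y t = p ∧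
      y b = Φ p ∧ (∀ s ∈ Icc t b, ‖y s - x s‖ ≤ C * ‖p - x t‖) ∧ ‖p - x t‖ ≤ C⁻¹ := by
    filter_upwards [hsmall, hΦ] with p hp ⟨z, hz, hzt, hzb⟩
    obtain ⟨y, hyc, hy, hyt, hyb⟩ := hC t ht p hp
    refine ⟨y, hyc, hy, hyt, ?_, hyb, hp⟩
    rw [← hzb]
    exact hy.eqOn hlip hz (hyt.trans hzt.symm) ⟨ht.2, le_rfl⟩
  choose! Y hY using fun p (hp : ∃ y, Continuous y ∧ IsIntegralCurve V t b y ∧ y t = p ∧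
      y b = Φ p ∧ (∀ s ∈ Icc t b, ‖y s - x s‖ ≤ C * ‖p - x t‖) ∧ ‖p - x t‖ ≤ C⁻¹) => hp
  replace hY := hgood.mono hY
  set A : ℝ → X →L[ℝ] X := fun s => fderiv ℝ (V s) (x s) with hAdef
  let rem : X → ℝ → ℝ := fun p s => α s (V s (Y p s) - V s (x s) - A s (Y p s - x s))
  obtain ⟨R, hR⟩ := isCompact_Icc.exists_bound_of_continuousOn (hα.continuousOn (s := Icc t b))
  have hR0 : 0 ≤ R := (norm_nonneg _).trans (hR t ⟨le_rfl, ht.2⟩)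
  have hrem : (fun p => ∫ s in t..b, rem p s) =o[𝓝 (x t)] fun p => p - x t := by
    rw [← Asymptotics.isLittleO_norm_right]
    -- At `p = x t` the quotient is a division by zero, so the numerator must be seen to vanish
    -- there.
    have h0 : ∀ᶠ p in 𝓝 (x t), ‖p - x t‖ = 0 → ∫ s in t..b, rem p s = 0 := by
      filter_upwards [hY] with p ⟨_, _, _, _, hb, _⟩ hp
      refine (intervalIntegral.integral_congr (g := fun _ => (0 : ℝ)) fun s hs => ?_).trans
        intervalIntegral.integral_zero
      rw [uIcc_of_le ht.2] at hs
      have := hb s hs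
      rw [hp, mul_zero, norm_le_zero_iff, sub_eq_zero] at this
      simp [rem, this]
    rw [Asymptotics.isLittleO_iff_tendsto' h0]
    have heq : ∀ p, (∫ s in t..b, rem p s) / ‖p - x t‖ = ∫ s in t..b, rem p s / ‖p - x t‖ :=
      fun p => (intervalIntegral.integral_div _ _).symm
    simp only [heq]
    have hlim := intervalIntegral.tendsto_integral_filter_of_dominated_convergence
      (μ := volume) (a := t) (b := b) (l := 𝓝 (x t)) (F := fun p s => rem p s / ‖p - x t‖)
      (f := fun _ => (0 : ℝ)) (fun _ => R * (K * C + K * C)) ?_ ?_ (by simp) ?_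
    · simpa using hlim
    · filter_upwards [hY] with p ⟨hyc, _⟩
      have hAe : StronglyMeasurable fun s => A s (Y p s - x s) :=
        (isBoundedBilinearMap_apply.continuous).comp_stronglyMeasurable
          (hA.prodMk (hyc.sub hxc).stronglyMeasurable)
      have hVe : StronglyMeasurable fun s => V s (Y p s) - V s (x s) :=
        ((hV.comp (continuous_id.prodMk hyc)).sub
          (hV.comp (continuous_id.prodMk hxc))).stronglyMeasurable
      have : StronglyMeasurable (rem p) :=
        (isBoundedBilinearMap_apply.continuous).comp_stronglyMeasurable
          (hα.stronglyMeasurable.prodMk (hVe.sub hAe))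
      exact (this.measurable.div_const _).aestronglyMeasurable
    · filter_upwards [hY] with p ⟨_, _, _, _, hb, hp⟩
      refine Eventually.of_forall fun s hs => ?_
      rw [uIoc_of_le ht.2] at hs
      have hs' : s ∈ Icc t b := Ioc_subset_Icc_self hs
      have hbs := hb s hs'
      have h1 : ‖Y p s - x s‖ ≤ 1 := by
        refine hbs.trans ((mul_le_mul_of_nonneg_left hp hC0.le).trans ?_)
        rw [mul_inv_cancel₀ hC0.ne']
      have hYm : Y p s ∈ Metric.closedBall (0 : X) (M + 1) := by
        rw [mem_closedBall_zero_iff]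
        calc ‖Y p s‖ = ‖x s + (Y p s - x s)‖ := by congr 1; abel
          _ ≤ M + 1 := (norm_add_le _ _).trans (add_le_add (hM s) h1)
      have h2 := (hK s).dist_le_mul _ hYm _ (mem_of_mem_nhds (hball s))
      rw [dist_eq_norm, dist_eq_norm] at h2
      have h3 : ‖rem p s‖ ≤ R * (K * (C * ‖p - x t‖) + K * (C * ‖p - x t‖)) := by
        refine ((α s).le_opNorm _).trans ?_
        gcongr
        · exact hR s hs'
        · refine (norm_sub_le _ _).trans (add_le_add ?_ ?_)
          · exact h2.trans (mul_le_mul_of_nonneg_left hbs K.2)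
          · exact ((A s).le_opNorm _).trans (mul_le_mul (hAK s) hbs (norm_nonneg _) K.2)
      rw [norm_div, norm_norm]
      refine div_le_of_le_mul₀ (norm_nonneg _) (by positivity) (h3.trans (le_of_eq ?_))
      ring
    -- At a fixed time of differentiability the error is `o(Y p s - x s)`, and `Y p s - x s` is `O(p
    -- - x t)`.
    · filter_upwards [hdiff] with s hs hst
      rw [uIoc_of_le ht.2] at hst
      have hs' : s ∈ Icc t b := Ioc_subset_Icc_self hst
      have hd := (hs ⟨ht.1.trans hs'.1, hs'.2⟩).hasFDerivAt.isLittleO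
      have hbig : (fun p => Y p s - x s) =O[𝓝 (x t)] fun p => p - x t := by
        refine Asymptotics.IsBigO.of_bound C ?_
        filter_upwards [hY] with p hp
        exact hp.2.2.2.2.1 s hs'
      have hten : Tendsto (fun p => Y p s) (𝓝 (x t)) (𝓝 (x s)) := by
        have h1 : Tendsto (fun p => p - x t) (𝓝 (x t)) (𝓝 0) := by
          have : Continuous fun p : X => p - x t := by fun_prop
          simpa using this.tendsto (x t)
        have := (hbig.trans_tendsto h1).add_const (x s)
        simpa using this
      have h4 := (hd.comp_tendsto hten).trans_isBigO hbig
      have h5 : (fun p => rem p s) =o[𝓝 (x t)] fun p => ‖p - x t‖ :=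
        (((α s).isBigO_comp _ _).trans_isLittleO h4).norm_right
      exact h5.tendsto_div_nhds_zero
  have hΦbig : (fun p => Φ p - x b) =O[𝓝 (x t)] fun p => p - x t := by
    refine Asymptotics.IsBigO.of_bound C ?_
    filter_upwards [hY] with p ⟨_, _, _, hb, hbd, _⟩
    rw [← hb]
    exact hbd b ⟨ht.2, le_rfl⟩
  have hΦx : Φ (x t) = x b := by
    obtain ⟨_, _, _, hb, hbd, _⟩ := hY.self_of_nhds
    have := hbd b ⟨ht.2, le_rfl⟩
    rw [sub_self, norm_zero, mul_zero, norm_le_zero_iff, sub_eq_zero] at this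
    rw [← hb, this]
  have hΦten : Tendsto Φ (𝓝 (x t)) (𝓝 (x b)) := by
    have h1 : Tendsto (fun p => p - x t) (𝓝 (x t)) (𝓝 0) := by
      have : Continuous fun p : X => p - x t := by fun_prop
      simpa using this.tendsto (x t)
    simpa using (hΦbig.trans_tendsto h1).add_const (x b)
  have hLo := (hL.isLittleO.comp_tendsto hΦten).trans_isBigO hΦbig
  refine HasFDerivAt.of_isLittleO ((hLo.add hrem).congr' ?_ EventuallyEq.rfl)
  filter_upwards [hY] with p ⟨hyc, hy, hyt, hb, _⟩
  have hpair := adjoint_pairing (a := t) (w := fun s => Y p s - x s)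
    (w' := fun s => V s (Y p s) - V s (x s)) hA hAK hα ht.2
    (fun s hs => hℓ s ⟨ht.1.trans hs.1, hs.2⟩)
    (fun s hs => (hy s hs).sub (hx.mono ht.1 s hs))
    (((hV.comp (continuous_id.prodMk hyc)).sub
          (hV.comp (continuous_id.prodMk hxc))).continuousOn)
  have hαb : α b = ℓ := by simpa using hℓ b ⟨ht.1.trans ht.2, le_rfl⟩
  simp only [hyt, hb, hαb] at hpair
  change L (Φ p) - L (x b) - ℓ (Φ p - x b) + (∫ s in t..b, rem p s) = _
  rw [hΦx, ← hpair]
  ring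

theorem eventually_existsUnique_final (hV : Continuous fun q : ℝ × X => V q.1 q.2)
    (hlip : ∀ R : ℝ, ∃ K : ℝ≥0, ∀ t, LipschitzOnWith K (V t) (Metric.closedBall 0 R))
    {x : ℝ → X} (hxc : Continuous x) {M : ℝ} (hM : ∀ t, ‖x t‖ ≤ M)
    (hx : IsIntegralCurve V a b x) {t : ℝ} (ht : t ∈ Icc a b) :
    ∀ᶠ p in 𝓝 (x t), ∃! q, ∃ y, IsIntegralCurve V t b y ∧ y t = p ∧ y b = q := by
  obtain ⟨C, hC0, hC⟩ := hx.exists_near hV hlip hxc hM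
  filter_upwards [Metric.closedBall_mem_nhds (x t) (inv_pos.2 hC0)] with p hp
  obtain ⟨y, hyc, hy, hyt, -⟩ := hC t ht p (by rwa [← dist_eq_norm])
  refine ⟨y b, ⟨y, hy, hyt, rfl⟩, ?_⟩
  rintro q ⟨z, hz, hzt, rfl⟩
  exact hz.eqOn hlip hy (hzt.trans hyt.symm) ⟨ht.2, le_rfl⟩

end Main
-- The componentwise activation.
section Activation
variable {N : ℕ} {σ : ℝ → ℝ}

theorem norm_le_of_abs_le {K : ℝ} (hK : 0 ≤ K) {x y : Feat N} (h : ∀ i, |x i| ≤ K * |y i|) :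
    ‖x‖ ≤ K * ‖y‖ := by
  rw [EuclideanSpace.norm_eq, EuclideanSpace.norm_eq]
  refine Real.sqrt_le_iff.2 ⟨by positivity, ?_⟩
  rw [mul_pow, Real.sq_sqrt (Finset.sum_nonneg fun _ _ => by positivity), Finset.mul_sum]
  refine Finset.sum_le_sum fun i _ => ?_
  rw [← mul_pow]
  exact pow_le_pow_left₀ (norm_nonneg _) (h i) 2

theorem exists_lipschitzOnWith_act (hσ : LocallyLipschitz σ) (R : ℝ) :
    ∃ K : ℝ≥0, LipschitzOnWith K (act σ : Feat N → Feat N) (Metric.closedBall 0 R) := by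
  obtain ⟨K, hK⟩ := (hσ.locallyLipschitzOn (s := Metric.closedBall (0 : ℝ) R)
    ).exists_lipschitzOnWith_of_compact (isCompact_closedBall 0 R)
  have hmem : ∀ x ∈ Metric.closedBall (0 : Feat N) R, ∀ i, x i ∈ Metric.closedBall (0 : ℝ) R := by
    intro x hx i
    rw [mem_closedBall_zero_iff] at hx ⊢
    exact (PiLp.norm_apply_le x i).trans hx
  refine ⟨K, LipschitzOnWith.of_dist_le_mul fun x hx y hy => ?_⟩
  rw [dist_eq_norm, dist_eq_norm]
  refine norm_le_of_abs_le K.2 fun i => ?_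
  have := hK.dist_le_mul _ (hmem x hx i) _ (hmem y hy i)
  rwa [Real.dist_eq, Real.dist_eq] at this

theorem hasFDerivAt_act {m : Feat N} (h : ∀ i, DifferentiableAt ℝ σ (m i)) :
    HasFDerivAt (act σ) (actDeriv σ m) m := by
  rw [← hasFDerivWithinAt_univ, hasFDerivWithinAt_euclidean]
  intro i
  rw [hasFDerivWithinAt_univ]
  have h1 : HasFDerivAt (fun x : Feat N => x i) (PiLp.proj 2 (fun _ : Fin N => ℝ) i) m :=
    (PiLp.proj 2 (fun _ : Fin N => ℝ) i : Feat N →L[ℝ] ℝ).hasFDerivAt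
  refine ((h i).hasDerivAt.comp_hasFDerivAt m h1).congr_fderiv ?_
  ext v
  simp [actDeriv, Matrix.mulVec_diagonal]

theorem continuous_actDeriv (hσ : ContDiff ℝ 1 σ) :
    Continuous (actDeriv σ : Feat N → Feat N →L[ℝ] Feat N) := by
  have h1 : Continuous (deriv σ) := hσ.continuous_deriv le_rfl
  let e : Matrix (Fin N) (Fin N) ℝ →ₗ[ℝ] (Feat N →L[ℝ] Feat N) :=
    (Matrix.toEuclideanCLM (n := Fin N) (𝕜 := ℝ)).toAlgEquiv.toLinearMap
  have h2 : Continuous e := e.continuous_of_finiteDimensional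
  exact h2.comp (Continuous.matrix_diagonal
    (continuous_pi fun i => h1.comp (PiLp.continuous_apply 2 _ i)))

end Activation

/-! ### The heavy ball field on the state space. -/

section Field
variable {N : ℕ} {Θ : Type*} (f : Feat N → ℝ → Θ → Feat N) (θ : Θ) (σ : ℝ → ℝ) (γ ξ : ℝ)

/-- The right-hand side of the heavy ball system on the state space. -/
noncomputable def field (t : ℝ) (p : Feat N × Feat N) : Feat N × Feat N :=
  (act σ p.2, -(γ • p.2) + f p.1 t θ - ξ • p.1)

/-- The Jacobian of the right-hand side of the heavy ball system. -/
noncomputable def fieldDeriv (t : ℝ) (p : Feat N × Feat N) :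
    Feat N × Feat N →L[ℝ] Feat N × Feat N :=
  ((actDeriv σ p.2).comp (ContinuousLinearMap.snd ℝ (Feat N) (Feat N))).prod
    (-(γ • ContinuousLinearMap.snd ℝ (Feat N) (Feat N))
      + (jac f θ p.1 t).comp (ContinuousLinearMap.fst ℝ (Feat N) (Feat N))
      - ξ • ContinuousLinearMap.fst ℝ (Feat N) (Feat N))

variable {f θ σ γ ξ}

theorem hasFDerivAt_field {t : ℝ} {p : Feat N × Feat N}
    (hf : DifferentiableAt ℝ (fun x => f x t θ) p.1) (hσ : ∀ i, DifferentiableAt ℝ σ (p.2 i)) :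
    HasFDerivAt (field f θ σ γ ξ t) (fieldDeriv f θ σ γ ξ t p) p := by
  have h1 := (hasFDerivAt_act hσ).comp p hasFDerivAt_snd
  have h2 := HasFDerivAt.comp p (f := Prod.fst) (g := fun x => f x t θ) hf.hasFDerivAt
    hasFDerivAt_fst
  exact h1.prodMk ((((hasFDerivAt_snd (p := p)).const_smul γ).neg.add h2).sub
    ((hasFDerivAt_fst (p := p)).const_smul ξ))

theorem isSolution_iff {a b : ℝ} {h m : ℝ → Feat N} :
    IsSolution f θ σ γ ξ a b h m ↔
      IsIntegralCurve (field f θ σ γ ξ) a b fun t => (h t, m t) :=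
  ⟨fun H t ht => (H t ht).1.prodMk (H t ht).2, fun H t ht => ⟨(H t ht).fst, (H t ht).snd⟩⟩

theorem reaches_iff {a b : ℝ} {p q : Feat N × Feat N} :
    Reaches f θ σ γ ξ a b p q ↔
      ∃ y, IsIntegralCurve (field f θ σ γ ξ) a b y ∧ y a = p ∧ y b = q := by
  constructor
  · rintro ⟨h, m, H, hp, hq⟩
    exact ⟨_, isSolution_iff.1 H, hp, hq⟩
  · rintro ⟨y, H, hp, hq⟩
    exact ⟨fun t => (y t).1, fun t => (y t).2, isSolution_iff.2 H, hp, hq⟩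

variable {t₀ T : ℝ}

theorem exists_lipschitzOnWith_field (hd : LipschitzData f θ σ t₀ T) (R : ℝ) :
    ∃ K : ℝ≥0, ∀ t ∈ Icc t₀ T,
      LipschitzOnWith K (field f θ σ γ ξ t) (Metric.closedBall 0 R) := by
  obtain ⟨K₁, h₁⟩ := hd.2.1 R
  obtain ⟨K₂, h₂⟩ := exists_lipschitzOnWith_act (N := N) hd.2.2 R
  have hmem : ∀ p ∈ Metric.closedBall (0 : Feat N × Feat N) R,
      p.1 ∈ Metric.closedBall (0 : Feat N) R ∧ p.2 ∈ Metric.closedBall (0 : Feat N) R := by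
    intro p hp
    simp only [mem_closedBall_zero_iff] at hp ⊢
    exact ⟨(norm_fst_le p).trans hp, (norm_snd_le p).trans hp⟩
  refine ⟨K₂ + (‖γ‖₊ + K₁ + ‖ξ‖₊), fun t ht => LipschitzOnWith.of_dist_le_mul fun p hp q hq => ?_⟩
  have e1 := (h₁ t ht).dist_le_mul _ (hmem p hp).1 _ (hmem q hq).1
  have e2 := h₂.dist_le_mul _ (hmem p hp).2 _ (hmem q hq).2
  have d1 : dist p.1 q.1 ≤ dist p q := le_max_left _ _
  have d2 : dist p.2 q.2 ≤ dist p q := le_max_right _ _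
  have e3 : dist (γ • p.2) (γ • q.2) = ‖γ‖ * dist p.2 q.2 := dist_smul₀ _ _ _
  have e4 : dist (ξ • p.1) (ξ • q.1) = ‖ξ‖ * dist p.1 q.1 := dist_smul₀ _ _ _
  have e5 : dist (field f θ σ γ ξ t p).2 (field f θ σ γ ξ t q).2 ≤
      (‖γ‖ * dist p.2 q.2 + K₁ * dist p.1 q.1) + ‖ξ‖ * dist p.1 q.1 := by
    rw [← e4]
    refine (dist_sub_sub_le _ _ _ _).trans (add_le_add ((dist_add_add_le _ _ _ _).trans ?_) le_rfl)
    rw [dist_neg_neg, e3]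
    exact add_le_add le_rfl e1
  have g := mul_le_mul_of_nonneg_left d2 (norm_nonneg γ)
  have x := mul_le_mul_of_nonneg_left d1 (norm_nonneg ξ)
  have k1 := mul_le_mul_of_nonneg_left d1 K₁.2
  have k2 := mul_le_mul_of_nonneg_left d2 K₂.2
  have D : 0 ≤ dist p q := dist_nonneg
  have P1 : 0 ≤ ‖γ‖ * dist p q := by positivity
  have P2 : 0 ≤ ‖ξ‖ * dist p q := by positivity
  have P3 : 0 ≤ K₁ * dist p q := by positivity
  have P4 : 0 ≤ K₂ * dist p q := by positivity
  simp only [NNReal.val_eq_coe] at k1 k2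
  push_cast
  refine max_le ?_ ?_
  · refine e2.trans ?_
    linarith
  · refine e5.trans ?_
    linarith

theorem continuousOn_field (hd : LipschitzData f θ σ t₀ T) (p : Feat N × Feat N) :
    ContinuousOn (fun t => field f θ σ γ ξ t p) (Icc t₀ T) :=
  continuousOn_const.prodMk ((continuousOn_const.add (hd.1 p.1)).sub continuousOn_const)

theorem SmoothData.lipschitzData (hd : SmoothData f θ σ t₀ T) : LipschitzData f θ σ t₀ T := by
  obtain ⟨hf, hdf, hj, hσ⟩ := hd
  refine ⟨fun x => hf.comp (continuousOn_const.prodMk continuousOn_id)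
    fun t ht => ⟨mem_univ _, ht⟩, fun R => ?_, hσ.locallyLipschitz⟩
  obtain ⟨K, hK⟩ := ((isCompact_closedBall (0 : Feat N) R).prod
    (isCompact_Icc (a := t₀) (b := T))).exists_bound_of_continuousOn
      (hj.mono (prod_mono_left (subset_univ _)))
  refine ⟨K.toNNReal, fun t ht => (convex_closedBall 0 R).lipschitzOnWith_of_nnnorm_fderiv_le
    (𝕜 := ℝ) (fun x _ => hdf t ht x) fun x hx => ?_⟩
  rw [← NNReal.coe_le_coe, coe_nnnorm]
  exact (hK (x, t) ⟨hx, ht⟩).trans (Real.le_coe_toNNReal K)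

theorem continuousOn_clm_prod {S E F G : Type*} [TopologicalSpace S] [NormedAddCommGroup E]
    [NormedSpace ℝ E] [NormedAddCommGroup F] [NormedSpace ℝ F] [NormedAddCommGroup G]
    [NormedSpace ℝ G] {u : S → E →L[ℝ] F} {v : S → E →L[ℝ] G} {s : Set S} (hu : ContinuousOn u s)
    (hv : ContinuousOn v s) : ContinuousOn (fun t => (u t).prod (v t)) s :=
  (ContinuousLinearMap.prodₗᵢ (𝕜 := ℝ) (E := E) (F := F) (G := G) ℝ).continuous.comp_continuousOn
    (hu.prodMk hv)

theorem SmoothData.continuousOn_fieldDeriv (hd : SmoothData f θ σ t₀ T)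
    {y : ℝ → Feat N × Feat N} (hy : ContinuousOn y (Icc t₀ T)) :
    ContinuousOn (fun s => fieldDeriv f θ σ γ ξ s (y s)) (Icc t₀ T) := by
  have hj : ContinuousOn (fun s => jac f θ (y s).1 s) (Icc t₀ T) :=
    hd.2.2.1.comp (hy.fst.prodMk continuousOn_id) fun s hs => ⟨mem_univ _, hs⟩
  have ha : ContinuousOn (fun s => actDeriv σ (y s).2) (Icc t₀ T) :=
    (continuous_actDeriv hd.2.2.2).comp_continuousOn hy.snd
  have h1 := ha.clm_comp (continuousOn_const (c := ContinuousLinearMap.snd ℝ (Feat N) (Feat N)))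
  have h2 := hj.clm_comp (continuousOn_const (c := ContinuousLinearMap.fst ℝ (Feat N) (Feat N)))
  exact continuousOn_clm_prod h1 ((continuousOn_const.add h2).sub continuousOn_const)

theorem IsIntegralCurve.congr {X : Type*} [NormedAddCommGroup X] [NormedSpace ℝ X]
    {V W : ℝ → X → X} {a b : ℝ} (hVW : ∀ t ∈ Icc a b, V t = W t) {y z : ℝ → X}
    (hyz : EqOn z y (Icc a b)) (hy : IsIntegralCurve V a b y) : IsIntegralCurve W a b z := by
  intro t ht
  rw [← hVW t ht, hyz ht]
  exact (hy t ht).congr hyz (hyz ht)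

/-- The derivative of the loss in the state at time `t`, along a solution, solves the integrated
adjoint equation. -/
theorem exists_adjoint_states (hT : t₀ < T) {h m : ℝ → Feat N}
    (hsol : IsSolution f θ σ γ ξ t₀ T h m) {L : Feat N × Feat N → ℝ}
    (hL : DifferentiableAt ℝ L (h T, m T)) (hd : LipschitzData f θ σ t₀ T)
    (hae : ∀ᵐ t ∂(volume.restrict (Icc t₀ T)),
      DifferentiableAt ℝ (fun x => f x t θ) (h t) ∧ ∀ i, DifferentiableAt ℝ σ (m t i)) :
    ∃ (α : ℝ → (Feat N × Feat N →L[ℝ] ℝ)) (A : ℝ → (Feat N × Feat N →L[ℝ] Feat N × Feat N)),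
      Continuous α ∧
      (∀ t ∈ Icc t₀ T, (∀ᶠ p in 𝓝 (h t, m t), ∃! q, Reaches f θ σ γ ξ t T p q) ∧
        HasFDerivAt (lossFrom f θ σ γ ξ T L t) (α t) (h t, m t)) ∧
      α T = fderiv ℝ L (h T, m T) ∧
      (∃ K : ℝ≥0, LipschitzOnWith K α (Icc t₀ T)) ∧
      (∀ c d, IntervalIntegrable (fun s => (α s).comp (A s)) volume c d) ∧
      (∀ t ∈ Icc t₀ T, α t = α T + ∫ s in t..T, (α s).comp (A s)) ∧
      ∀ t ∈ Icc t₀ T, DifferentiableAt ℝ (fun x => f x t θ) (h t) →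
        (∀ i, DifferentiableAt ℝ σ (m t i)) → A t = fieldDeriv f θ σ γ ξ t (h t, m t) := by
  -- Clamping time to the interval extends the field and the trajectory so that continuity and the
  -- bounds hold at all real times.
  let c : ℝ → ℝ := fun s => projIcc t₀ T hT.le s
  have hc : Continuous c := continuous_subtype_val.comp continuous_projIcc
  have hcm : ∀ s, c s ∈ Icc t₀ T := fun s => (projIcc t₀ T hT.le s).2
  have hce : ∀ s ∈ Icc t₀ T, c s = s := fun s hs => by simp [c, projIcc_of_mem hT.le hs]
  let V : ℝ → Feat N × Feat N → Feat N × Feat N := fun s => field f θ σ γ ξ (c s)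
  let x : ℝ → Feat N × Feat N := fun s => (h (c s), m (c s))
  have hVe : ∀ s ∈ Icc t₀ T, field f θ σ γ ξ s = V s := fun s hs => by simp only [V, hce s hs]
  have hxe : EqOn x (fun s => (h s, m s)) (Icc t₀ T) := fun s hs => by simp only [x, hce s hs]
  have hcurve := isSolution_iff.1 hsol
  have hxc : Continuous x := hcurve.continuousOn.comp_continuous hc hcm
  obtain ⟨M, hM⟩ := isCompact_Icc.exists_bound_of_continuousOn hcurve.continuousOn
  have hxM : ∀ s, ‖x s‖ ≤ M := fun s => hM _ (hcm s)
  have hx : IsIntegralCurve V t₀ T x := hcurve.congr hVe hxe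
  have hlip : ∀ R : ℝ, ∃ K : ℝ≥0, ∀ t, LipschitzOnWith K (V t) (Metric.closedBall 0 R) := by
    intro R
    obtain ⟨K, hK⟩ := exists_lipschitzOnWith_field (γ := γ) (ξ := ξ) hd R
    exact ⟨K, fun t => hK _ (hcm t)⟩
  have hV : Continuous fun q : ℝ × (Feat N × Feat N) => V q.1 q.2 := by
    rw [continuous_iff_continuousAt]
    rintro ⟨s, p⟩
    -- Continuity in time and a Lipschitz bound in the state, uniform in time on a ball around `p`,
    -- give joint continuity.
    obtain ⟨K, hK⟩ := hlip (‖p‖ + 1)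
    have hon := continuousOn_prod_of_continuousOn_lipschitzOnWith'
      (fun q : ℝ × (Feat N × Feat N) => V q.1 q.2) (s := univ)
      (t := Metric.closedBall 0 (‖p‖ + 1)) K (fun a _ => hK a)
      (fun b _ => ((continuousOn_field hd b).comp_continuous hc hcm).continuousOn)
    refine hon.continuousAt (prod_mem_nhds univ_mem (Metric.closedBall_mem_nhds_of_mem ?_))
    simp
  have hreach : ∀ t ∈ Icc t₀ T, ∀ p q, Reaches f θ σ γ ξ t T p q ↔
      ∃ y, IsIntegralCurve V t T y ∧ y t = p ∧ y T = q := by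
    intro t ht p q
    have hVt : ∀ s ∈ Icc t T, field f θ σ γ ξ s = V s := fun s hs => hVe s ⟨ht.1.trans hs.1, hs.2⟩
    rw [reaches_iff]
    exact exists_congr fun y => and_congr_left fun _ =>
      ⟨fun H => H.congr hVt (eqOn_refl _ _),
        fun H => H.congr (fun s hs => (hVt s hs).symm) (eqOn_refl _ _)⟩
  have hdf : ∀ t ∈ Icc t₀ T, DifferentiableAt ℝ (fun x => f x t θ) (h t) →
      (∀ i, DifferentiableAt ℝ σ (m t i)) →
      HasFDerivAt (V t) (fieldDeriv f θ σ γ ξ t (h t, m t)) (x t) := by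
    intro t ht h1 h2
    rw [← hVe t ht, hxe ht]
    exact hasFDerivAt_field h1 h2
  have hdiff : ∀ᵐ s, s ∈ Icc t₀ T → DifferentiableAt ℝ (V s) (x s) := by
    filter_upwards [(ae_restrict_iff' measurableSet_Icc).1 hae] with s hs hm
    exact (hdf s hm (hs hm).1 (hs hm).2).differentiableAt
  -- Joint continuity of the field makes its derivative measurable in time and state together,
  -- without any assumption on how the derivative varies.
  have hA : StronglyMeasurable fun s => fderiv ℝ (V s) (x s) :=
    ((measurable_fderiv_with_param ℝ hV).comp
      (measurable_id.prodMk hxc.measurable)).stronglyMeasurable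
  obtain ⟨K, hK⟩ := hlip (M + 1)
  have hAK : ∀ s, ‖fderiv ℝ (V s) (x s)‖ ≤ K := fun s =>
    norm_fderiv_le_of_lipschitzOn ℝ (Metric.closedBall_mem_nhds_of_mem
      (by rw [mem_ball_zero_iff]; exact (hxM s).trans_lt (lt_add_one M))) (hK s)
  obtain ⟨α, hα, hℓ⟩ := exists_adjoint hA hAK hT.le (fderiv ℝ L (h T, m T))
  have hTm : T ∈ Icc t₀ T := ⟨hT.le, le_rfl⟩
  have hαT : α T = fderiv ℝ L (h T, m T) := by simpa using hℓ T hTm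
  refine ⟨α, _, hα, fun t ht => ?_, hαT, lipschitzOnWith_of_integral_equation hA hAK hα hℓ,
    intervalIntegrable_comp hA hAK hα, fun t ht => by rw [hαT]; exact hℓ t ht,
    fun t ht h1 h2 => (hdf t ht h1 h2).fderiv⟩
  have hxt : x t = (h t, m t) := hxe ht
  have hu := eventually_existsUnique_final hV hlip hxc hxM hx ht
  rw [hxt] at hu
  refine ⟨?_, ?_⟩
  · filter_upwards [hu] with p hp
    simpa only [hreach t ht] using hp
  · rw [← hxt]
    have hL' : HasFDerivAt L (fderiv ℝ L (h T, m T)) (x T) := by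
      rw [hxe hTm]; exact hL.hasFDerivAt
    refine hasFDerivAt_of_adjoint hV hlip hxc hxM hx hdiff hA hα hL' hℓ ht ?_
    rw [hxt]
    filter_upwards [hu] with p hp
    rw [← hreach t ht]
    -- Some final state is reached from `p`, so the chosen `finalState` is indeed reached.
    exact Classical.epsilon_spec (p := fun q => Reaches f θ σ γ ξ t T p q)
      ⟨hp.choose, (hreach t ht _ _).2 hp.choose_spec.1⟩

/-! ### Splitting the adjoint into its two components. -/

section Components
variable {h m : ℝ → Feat N} {L : Feat N × Feat N → ℝ} {t : ℝ} {α : ℝ → (Feat N × Feat N →L[ℝ] ℝ)}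

theorem adjointH_eq (hα : HasFDerivAt (lossFrom f θ σ γ ξ T L t) (α t) (h t, m t)) :
    adjointH f θ σ γ ξ T L h m t = (α t).comp (ContinuousLinearMap.inl ℝ _ _) :=
  (HasFDerivAt.comp (g := lossFrom f θ σ γ ξ T L t) (h t) hα (hasFDerivAt_prodMk_left (h t) (m t))).fderiv

theorem adjointM_eq (hα : HasFDerivAt (lossFrom f θ σ γ ξ T L t) (α t) (h t, m t)) :
    adjointM f θ σ γ ξ T L h m t = (α t).comp (ContinuousLinearMap.inr ℝ _ _) :=
  (HasFDerivAt.comp (g := lossFrom f θ σ γ ξ T L t) (m t) hα (hasFDerivAt_prodMk_right (h t) (m t))).fderiv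

theorem adjointFinalValues_of_hasFDerivAt (hL : DifferentiableAt ℝ L (h T, m T))
    (hα : HasFDerivAt (lossFrom f θ σ γ ξ T L T) (α T) (h T, m T))
    (hαT : α T = fderiv ℝ L (h T, m T)) : AdjointFinalValues f θ σ γ ξ T L h m := by
  refine ⟨?_, ?_⟩
  · rw [adjointH_eq hα, hαT]
    exact (HasFDerivAt.comp (h T) hL.hasFDerivAt
      (hasFDerivAt_prodMk_left (h T) (m T))).fderiv.symm
  · rw [adjointM_eq hα, hαT]
    exact (HasFDerivAt.comp (m T) hL.hasFDerivAt
      (hasFDerivAt_prodMk_right (h T) (m T))).fderiv.symm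

/-- The field has block Jacobian with rows `(0, σ')` and `(∂f/∂h - ξ I, -γ I)`. Restricting `α' = -α
A` to each factor reads off its columns. -/
theorem adjointEquationsAt_of_hasDerivWithinAt
    (hα : ∀ t ∈ Icc t₀ T, HasFDerivAt (lossFrom f θ σ γ ξ T L t) (α t) (h t, m t))
    (ht : t ∈ Icc t₀ T)
    (hd : HasDerivWithinAt α (-((α t).comp (fieldDeriv f θ σ γ ξ t (h t, m t)))) (Icc t₀ T) t) :
    AdjointEquationsAt f θ σ γ ξ t₀ T L h m t := by
  have hH : EqOn (adjointH f θ σ γ ξ T L h m)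
      (fun s => (α s).comp (ContinuousLinearMap.inl ℝ _ _)) (Icc t₀ T) :=
    fun s hs => adjointH_eq (hα s hs)
  have hM : EqOn (adjointM f θ σ γ ξ T L h m)
      (fun s => (α s).comp (ContinuousLinearMap.inr ℝ _ _)) (Icc t₀ T) :=
    fun s hs => adjointM_eq (hα s hs)
  have hsplit : ∀ u v : Feat N, α t (u, v) = α t (u, 0) + α t (0, v) := fun u v => by
    rw [← map_add]; simp
  refine ⟨?_, ?_⟩
  · have := hd.clm_comp (hasDerivWithinAt_const t (Icc t₀ T)
      (ContinuousLinearMap.inl ℝ (Feat N) (Feat N)))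
    refine (this.congr hH (hH ht)).congr_deriv ?_
    rw [hM ht]
    ext v
    have hs : α t (0, jac f θ (h t) t v - ξ • v) = α t (0, jac f θ (h t) t v) - ξ * α t (0, v) := by
      rw [← smul_eq_mul, ← map_smul, ← map_sub]
      simp
    simp [fieldDeriv, hs]
  · have := hd.clm_comp (hasDerivWithinAt_const t (Icc t₀ T)
      (ContinuousLinearMap.inr ℝ (Feat N) (Feat N)))
    refine (this.congr hM (hM ht)).congr_deriv ?_
    rw [hM ht, hH ht]
    ext v
    have hs := hsplit (actDeriv σ (m t) v) (-(γ • v))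
    have hg : α t (0, -(γ • v)) = -(γ * α t (0, v)) := by
      have : ((0 : Feat N), -(γ • v)) = -(γ • ((0 : Feat N), v)) := by simp
      rw [this, map_neg, map_smul, smul_eq_mul]
    rw [hg] at hs
    simp [fieldDeriv, hs, add_comm]

end Components

end Field
end GHBNODE

/-! ### The two regularity cases. -/

open GHBNODE in
theorem proposition3 {N : ℕ} {Θ : Type*} (f : Feat N → ℝ → Θ → Feat N) (θ : Θ) (σ : ℝ → ℝ)
    (γ ξ t₀ T : ℝ) (hT : t₀ < T) (h m : ℝ → Feat N)
    (hsol : GHBNODE.IsSolution f θ σ γ ξ t₀ T h m)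
    (L : Feat N × Feat N → ℝ) (hL : DifferentiableAt ℝ L (h T, m T)) :
    -- continuously differentiable data: the equations hold at every time
    (GHBNODE.SmoothData f θ σ t₀ T →
      (∀ t ∈ Icc t₀ T, GHBNODE.AdjointExistsAt f θ σ γ ξ T L h m t) ∧
      GHBNODE.AdjointFinalValues f θ σ γ ξ T L h m ∧
      ∀ t ∈ Icc t₀ T, GHBNODE.AdjointEquationsAt f θ σ γ ξ t₀ T L h m t) ∧
    -- Lipschitz data: the adjoint states are Lipschitz and the equations hold at almost every time
    (GHBNODE.LipschitzData f θ σ t₀ T →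
      (∀ᵐ t ∂(volume.restrict (Icc t₀ T)),
        DifferentiableAt ℝ (fun x => f x t θ) (h t) ∧ ∀ i, DifferentiableAt ℝ σ (m t i)) →
      (∀ t ∈ Icc t₀ T, GHBNODE.AdjointExistsAt f θ σ γ ξ T L h m t) ∧
      GHBNODE.AdjointFinalValues f θ σ γ ξ T L h m ∧
      (∃ K : ℝ≥0, LipschitzOnWith K (GHBNODE.adjointH f θ σ γ ξ T L h m) (Icc t₀ T)) ∧
      (∃ K : ℝ≥0, LipschitzOnWith K (GHBNODE.adjointM f θ σ γ ξ T L h m) (Icc t₀ T)) ∧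
      ∀ᵐ t ∂(volume.restrict (Icc t₀ T)),
        GHBNODE.AdjointEquationsAt f θ σ γ ξ t₀ T L h m t) := by
  have hTm : T ∈ Icc t₀ T := ⟨hT.le, le_rfl⟩
  refine ⟨fun hd => ?_, fun hd hae => ?_⟩
  · have hdiff : ∀ t ∈ Icc t₀ T, DifferentiableAt ℝ (fun x => f x t θ) (h t) ∧
        ∀ i, DifferentiableAt ℝ σ (m t i) := fun t ht =>
      ⟨hd.2.1 t ht _, fun i => hd.2.2.2.differentiable one_ne_zero _⟩
    obtain ⟨α, A, hαc, hα, hαT, -, hint, heq, hA⟩ := exists_adjoint_states hT hsol hL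
      hd.lipschitzData ((ae_restrict_iff' measurableSet_Icc).2 (Eventually.of_forall hdiff))
    refine ⟨fun t ht => ⟨(hα t ht).1, (hα t ht).2.differentiableAt⟩,
      adjointFinalValues_of_hasFDerivAt hL (hα T hTm).2 hαT, fun t ht =>
      adjointEquationsAt_of_hasDerivWithinAt (fun s hs => (hα s hs).2) ht ?_⟩
    have hhm : ContinuousOn (fun s => (h s, m s)) (Icc t₀ T) := (isSolution_iff.1 hsol).continuousOn
    have hAc : ContinuousOn A (Icc t₀ T) :=
      (hd.continuousOn_fieldDeriv (γ := γ) (ξ := ξ) hhm).congr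
        fun s hs => hA s hs (hdiff s hs).1 (hdiff s hs).2
    have hφ : ContinuousOn (fun s => (α s).comp (A s)) (Icc t₀ T) := hαc.continuousOn.clm_comp hAc
    -- This makes the fundamental theorem of calculus available within the closed interval, end
    -- points included.
    have : Fact (t ∈ Icc t₀ T) := ⟨ht⟩
    have hder := ((intervalIntegral.integral_hasDerivWithinAt_left (s := Icc t₀ T)
      (t := Icc t₀ T) (hint t T)
      (hφ.stronglyMeasurableAtFilter_nhdsWithin measurableSet_Icc t) (hφ t ht)).const_add (α T))
    rw [← hA t ht (hdiff t ht).1 (hdiff t ht).2]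
    exact hder.congr heq (heq t ht)
  · obtain ⟨α, A, hαc, hα, hαT, ⟨K, hK⟩, hint, heq, hA⟩ :=
      exists_adjoint_states hT hsol hL hd hae
    refine ⟨fun t ht => ⟨(hα t ht).1, (hα t ht).2.differentiableAt⟩,
      adjointFinalValues_of_hasFDerivAt hL (hα T hTm).2 hαT, ?_, ?_, ?_⟩
    -- Restriction of a functional to one factor is a bounded linear operation, so the Lipschitz
    -- property passes from `α` to its component.
    · let Λ := (ContinuousLinearMap.compL ℝ (Feat N) (Feat N × Feat N) ℝ).flip
        (ContinuousLinearMap.inl ℝ _ _)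
      have := Λ.lipschitz.comp_lipschitzOnWith hK
      refine ⟨‖Λ‖₊ * K, fun s hs t ht => ?_⟩
      rw [adjointH_eq (hα s hs).2, adjointH_eq (hα t ht).2]
      exact this hs ht
    · let Λ := (ContinuousLinearMap.compL ℝ (Feat N) (Feat N × Feat N) ℝ).flip
        (ContinuousLinearMap.inr ℝ _ _)
      have := Λ.lipschitz.comp_lipschitzOnWith hK
      refine ⟨‖Λ‖₊ * K, fun s hs t ht => ?_⟩
      rw [adjointM_eq (hα s hs).2, adjointM_eq (hα t ht).2]
      exact this hs ht
    · rw [ae_restrict_iff' measurableSet_Icc] at hae ⊢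
      filter_upwards [hae, (hint t₀ T).ae_hasDerivAt_integral] with t hdt hdi ht
      refine adjointEquationsAt_of_hasDerivWithinAt (fun s hs => (hα s hs).2) ht ?_
      rw [← hA t ht (hdt ht).1 (hdt ht).2]
      have := ((hdi (by rwa [uIcc_of_le hT.le]) T right_mem_uIcc).const_sub (α T)).hasDerivWithinAt
        (s := Icc t₀ T)
      refine this.congr (fun s hs => ?_) ?_
      · rw [heq s hs, intervalIntegral.integral_symm, sub_eq_add_neg]
      · rw [heq t ht, intervalIntegral.integral_symm, sub_eq_add_neg]
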